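/- Let $q\in(-1,1]$, let $H$ be a complex Hilbert space with an orthonormal sequence $(e_k)_{k\in\mathbb N}$, and let $(\alpha_k)_{k\ge1}$ be an arbitrary sequence of complex numbers. On $q$-Fock space over $H$, with vacuum vector $\Omega$ and $q$-inner product $$\langle \xi_1\otimes\dots\otimes\xi_m,\eta_1\otimes\dots\otimes\eta_n\rangle_q=\delta_{m,n}\sum_{\sigma\in S_n}q^{|\sigma|}\prod_{i=1}^n\langle\xi_i,\eta_{\sigma^{-1}(i)}\rangle ,$$ where $|\sigma|$ is the number of inversions of $\sigma$, let $L(\xi)\,\eta_1\otimes\dots\otimes\eta_n=\xi\otimes\eta_1\otimes\dots\otimes\eta_n$ and $L_q^*(\xi)\,\eta_1\otimes\dots\otimes\eta_n=\sum_{k=1}^n q^{k-1}\langle\xi,\eta_k\rangle\,\eta_1\otimes\dots\widehat{\eta_k}\dots\otimes\eta_n$, so that $L_q^*(\xi)\Omega=0$, be the creation and annihilation operators. Let $\rho(X)=\langle\Omega,X\Omega\rangle_q$ be the vacuum expectation. Put $[n]_q=1+q+\dots+q^{n-1}$ and $[n]_q!=[1]_q[2]_q\cdots[n]_q$. Consider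 the exchangeable copies $$T^{(i)}=L_q^*(e_i)+\sum_{k=0}^\infty\frac{\alpha_{k+1}}{[k]_q!}\,L(e_i)^k\qquad(i\in\mathbb N)$$ of the $q$-Toeplitz operator $T$. No convergence condition is imposed on $(\alpha_k)$: the series is formal, that is, these operators act on formal sums $\sum_n\eta_n$ with $\eta_n\in H^{\otimes n}$, where each homogeneous component of the result is a finite sum. Let $n\ge0$. The mixed moment $\rho(T^{(h(1))}T^{(h(2))}\cdots T^{(h(n))})$ depends on $h:\{1,\dots,n\}\to\mathbb N$ only through its kernel, the partition $\sigma$ of $\{1,\dots,n\}$ with $i\sim_\sigma j\iff h(i)=h(j)$; denote it by $\rho_\sigma(T)$. For a partition $\pi$ of $\{1,\dots,n\}$ define the partitioned cumulant $$K^q_\pi(T)=\sum_{\sigma\le\pi}\rho_\sigma(T)\,\mu(\sigma,\pi),$$ where $\mu$ is the Möbius function of the lattice of set partitions of $\{1,\dots,n\}$ ordered by refinement. Then for every partition $\pi$ of $\{1,\dots,n\}$ $$K^q_\pi(T)=q^{rrc(\pi)}\prod_{B\in\pi}\alpha_{|B|},$$ where $rrc(\pi)$ is the number of right reduced crossings of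 $\pi$, that is, the number of quadruples $i<i'<j<j'$ in $\{1,\dots,n\}$ such that $i,j\in B$ and $i',j'\in B'$ for some blocks $B,B'$ of $\pi$ with $j=\max B$ and $j'=\max B'$. -/

import Mathlib

open scoped TensorProduct

noncomputable section

namespace QToeplitz

/-! ## `q`-numbers -/

/-- The `q`-number `[n]_q = 1 + q + ⋯ + q^(n-1)`. -/
def qNumber (q : ℝ) (n : ℕ) : ℝ := ∑ i ∈ Finset.range n, q ^ i

/-- The `q`-factorial `[n]_q! = [1]_q [2]_q ⋯ [n]_q`. -/
def qFactorial (q : ℝ) (n : ℕ) : ℝ := ∏ i ∈ Finset.range n, qNumber q (i + 1)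

/-! ## `q`-Fock space

The operators act on the space `∏ₙ H^{⊗n}` of all formal sums of homogeneous tensors.  It contains
the algebraic Fock space `⨁ₙ H^{⊗n}` (the finitely supported sequences), and every power series in
a creation operator acts on it, without any condition on the coefficients. -/

variable {H : Type*} [NormedAddCommGroup H] [InnerProductSpace ℂ H]

variable (H) in
/-- Formal sums `∑ₙ ηₙ` of homogeneous tensors `ηₙ ∈ H^{⊗n}`. -/
abbrev FormalFock : Type _ := (n : ℕ) → ⨂[ℂ]^n H

variable (H) in
/-- The vacuum vector `Ω`: the empty tensor, in degree `0`. -/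
def vacuum : FormalFock H := Pi.single 0 (PiTensorProduct.tprod ℂ (Fin.elim0 : Fin 0 → H))

/-- The number `|σ|` of inversions of a permutation. -/
def inversions {n : ℕ} (σ : Equiv.Perm (Fin n)) : ℕ :=
  (Finset.univ.filter fun p : Fin n × Fin n => p.1 < p.2 ∧ σ p.2 < σ p.1).card

variable (H) in
/-- The `q`-symmetrizator
`P_n^q (η₁ ⊗ ⋯ ⊗ ηₙ) = ∑_σ q^{|σ|} η_{σ⁻¹(1)} ⊗ ⋯ ⊗ η_{σ⁻¹(n)}`. -/
def qSymmetrizator (q : ℝ) (n : ℕ) : (⨂[ℂ]^n H) →ₗ[ℂ] (⨂[ℂ]^n H) :=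
  ∑ σ : Equiv.Perm (Fin n),
    ((q : ℂ) ^ inversions σ) •
      (PiTensorProduct.reindex ℂ (fun _ : Fin n => H) σ).toLinearMap

/-- The inner product with an elementary tensor,
`η₁ ⊗ ⋯ ⊗ ηₙ ↦ ⟨ξ₁, η₁⟩ ⋯ ⟨ξₙ, ηₙ⟩`. -/
def tensorInner {n : ℕ} (ξ : Fin n → H) : (⨂[ℂ]^n H) →ₗ[ℂ] ℂ :=
  PiTensorProduct.lift
    ((MultilinearMap.mkPiAlgebra ℂ (Fin n) ℂ).compLinearMap
      fun i => (innerSL ℂ (ξ i)).toLinearMap)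

/-- The `q`-inner product `⟨ξ₁ ⊗ ⋯ ⊗ ξₘ, η⟩_q = ⟨ξ₁ ⊗ ⋯ ⊗ ξₘ, P_m^q ηₘ⟩`; tensors of different
degrees are orthogonal. -/
def qInner (q : ℝ) {m : ℕ} (ξ : Fin m → H) (η : FormalFock H) : ℂ :=
  tensorInner ξ (qSymmetrizator H q m (η m))

/-- The vacuum expectation `ρ(X) = ⟨Ω, X Ω⟩_q`. -/
def vacuumExpectation (q : ℝ) (X : Module.End ℂ (FormalFock H)) : ℂ :=
  qInner q (Fin.elim0 : Fin 0 → H) (X (vacuum H))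

/-- Creation on homogeneous tensors, `η₁ ⊗ ⋯ ⊗ ηₙ ↦ ξ ⊗ η₁ ⊗ ⋯ ⊗ ηₙ`. -/
def creationHom (ξ : H) (n : ℕ) : (⨂[ℂ]^n H) →ₗ[ℂ] (⨂[ℂ]^(n + 1) H) :=
  PiTensorProduct.lift ((PiTensorProduct.tprod ℂ : MultilinearMap ℂ (fun _ : Fin (n + 1) => H)
    (⨂[ℂ]^(n + 1) H)).curryLeft ξ)

/-- Annihilation on homogeneous tensors,
`η₁ ⊗ ⋯ ⊗ ηₙ₊₁ ↦ ∑ₖ q^{k-1} ⟨ξ, ηₖ⟩ η₁ ⊗ ⋯ ⊗ η̂ₖ ⊗ ⋯ ⊗ ηₙ₊₁`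
(below `k` starts at `0`). -/
def annihilationHom (q : ℝ) (ξ : H) (n : ℕ) : (⨂[ℂ]^(n + 1) H) →ₗ[ℂ] (⨂[ℂ]^n H) :=
  ∑ k : Fin (n + 1), ((q : ℂ) ^ (k : ℕ)) •
    PiTensorProduct.lift
      (LinearMap.uncurryMid (M := fun _ : Fin (n + 1) => H) k
        ((innerSL ℂ ξ).toLinearMap.smulRight
          (PiTensorProduct.tprod ℂ : MultilinearMap ℂ (fun _ : Fin n => H) (⨂[ℂ]^n H))))

/-- The creation operator `L(ξ)`. -/
def creation (ξ : H) : Module.End ℂ (FormalFock H) :=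
  LinearMap.pi fun m => match m with
    | 0 => 0
    | n + 1 => creationHom ξ n ∘ₗ LinearMap.proj n

/-- The annihilation operator `L_q^*(ξ)`; in particular `L_q^*(ξ) Ω = 0`. -/
def annihilation (q : ℝ) (ξ : H) : Module.End ℂ (FormalFock H) :=
  LinearMap.pi fun n => annihilationHom q ξ n ∘ₗ LinearMap.proj (n + 1)

/-- `L(ξ)^k η` has no component of degree less than `k`. -/
theorem creation_pow_apply_of_lt (ξ : H) (η : FormalFock H) :
    ∀ {k m : ℕ}, m < k → (creation ξ ^ k) η m = 0
  | 0, m, h => absurd h (Nat.not_lt_zero m)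
  | k + 1, 0, _ => by rw [pow_succ']; rfl
  | k + 1, m + 1, h => by
    rw [pow_succ']
    change creationHom ξ m ((creation ξ ^ k) η m) = 0
    rw [creation_pow_apply_of_lt ξ η (Nat.lt_of_succ_lt_succ h), map_zero]

/-- The power series `∑_{k ≥ 0} c_k L(ξ)^k` in a creation operator.  In degree `m` only the terms
with `k ≤ m` contribute, see `creation_pow_apply_of_lt`. -/
def creationSeries (c : ℕ → ℂ) (ξ : H) : Module.End ℂ (FormalFock H) :=
  LinearMap.pi fun m => ∑ k ∈ Finset.range (m + 1), c k • (LinearMap.proj m ∘ₗ creation ξ ^ k)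

/-- The `q`-Toeplitz operator `T = L_q^*(ξ) + ∑_{k ≥ 0} (α_{k+1} / [k]_q!) L(ξ)^k`. -/
def toeplitz (q : ℝ) (α : ℕ → ℂ) (ξ : H) : Module.End ℂ (FormalFock H) :=
  annihilation q ξ + creationSeries (fun k => α (k + 1) / (qFactorial q k : ℂ)) ξ

/-! ## Partitions of `[n]` and cumulants -/

/-- Set partitions of an `n`-element linearly ordered set; `σ ≤ π` means that `σ` refines `π`. -/
abbrev SetPartition (n : ℕ) : Type := Finpartition (Finset.univ : Finset (Fin n))

instance (n : ℕ) : LocallyFiniteOrder (SetPartition n) :=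
  by classical exact Fintype.toLocallyFiniteOrder

/-- A partition as a function into `ℕ`: every block is numbered by its smallest element. -/
def blockNumber {n : ℕ} (π : SetPartition n) (i : Fin n) : ℕ :=
  ((π.part i).min' ⟨i, π.mem_part (Finset.mem_univ i)⟩ : Fin n)

/-- The index function `blockNumber π` has kernel `π`. -/
theorem blockNumber_eq_iff {n : ℕ} (π : SetPartition n) (i j : Fin n) :
    blockNumber π i = blockNumber π j ↔ ∃ B ∈ π.parts, i ∈ B ∧ j ∈ B := by
  rw [← Finpartition.mem_part_iff_exists]
  constructor
  · intro h
    have h' : (π.part i).min' ⟨i, π.mem_part (Finset.mem_univ i)⟩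
        = (π.part j).min' ⟨j, π.mem_part (Finset.mem_univ j)⟩ := Fin.ext h
    have hi := Finset.min'_mem (π.part i) ⟨i, π.mem_part (Finset.mem_univ i)⟩
    have hj := Finset.min'_mem (π.part j) ⟨j, π.mem_part (Finset.mem_univ j)⟩
    rw [h'] at hi
    have := π.eq_of_mem_parts (π.part_mem.2 (Finset.mem_univ i))
      (π.part_mem.2 (Finset.mem_univ j)) hi hj
    exact this ▸ π.mem_part (Finset.mem_univ i)
  · intro h
    have := (π.mem_part_iff_part_eq_part (Finset.mem_univ i) (Finset.mem_univ j)).1 h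
    simp only [blockNumber]
    congr 2

section Cumulants

variable {U : Type*} [Ring U] [Algebra ℂ U]

/-- The mixed moment `φ(X₁^{(h(1))} X₂^{(h(2))} ⋯ Xₙ^{(h(n))})`, where `X i k` is the `k`-th copy
`Xᵢ^{(k)}` of the `i`-th variable. -/
def mixedMoment (φ : U → ℂ) {n : ℕ} (X : Fin n → ℕ → U) (h : Fin n → ℕ) : ℂ :=
  φ (List.ofFn fun i => X i (h i)).prod

/-- `φ_π(X₁, …, Xₙ) = φ(X₁^{(π(1))} ⋯ Xₙ^{(π(n))})`. -/
def partitionedMoment (φ : U → ℂ) {n : ℕ} (X : Fin n → ℕ → U) (π : SetPartition n) : ℂ :=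
  mixedMoment φ X (blockNumber π)

open scoped Classical in
/-- The partitioned cumulant
`K_π(X₁, …, Xₙ) = ∑_{σ ≤ π} φ_σ(X₁, …, Xₙ) μ(σ, π)`, with `μ` the Möbius function of the lattice of
set partitions. -/
def partitionedCumulant (φ : U → ℂ) {n : ℕ} (X : Fin n → ℕ → U) (π : SetPartition n) : ℂ :=
  ∑ σ ∈ Finset.univ.filter (fun σ : SetPartition n => σ ≤ π),
    partitionedMoment φ X σ * IncidenceAlgebra.mu ℂ σ π

end Cumulants

open scoped Classical in
/-- The number of right reduced crossings of `π`: quadruples `i < i' < j < j'` with `i, j ∈ B` and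
`i', j' ∈ B'` for blocks `B`, `B'` of `π`, such that `j = max B` and `j' = max B'`. -/
def rrc {n : ℕ} (π : SetPartition n) : ℕ :=
  (Finset.univ.filter fun t : Fin n × Fin n × Fin n × Fin n =>
    match t with
    | (i, i', j, j') => i < i' ∧ i' < j ∧ j < j' ∧
      ∃ B ∈ π.parts, ∃ B' ∈ π.parts, i ∈ B ∧ i' ∈ B' ∧
        IsGreatest (B : Set (Fin n)) j ∧ IsGreatest (B' : Set (Fin n)) j').card

end QToeplitz

end

noncomputable section

namespace QToeplitz

/-! ### Commutation relations on `q`-Fock space and the vacuum component -/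

variable {H : Type*} [NormedAddCommGroup H] [InnerProductSpace ℂ H]

/-! By Möbius inversion it suffices to show that the moment at `σ` is the sum of `q^{rrc(π)} ∏
α_{|B|}` over all `π ≤ σ`.

Let the factors act on the vacuum from right to left, writing states as normalized words `∏ ξⱼ^{⊗ c
j} / [c j]_q!`. The factor at position `m` has two options. Its series part writes `k` copies of
`ξₘ` with weight `α_{k+1}`: this declares `m` the maximum of a block with `k` points still to come
on its left. Its annihilation part erases one copy of some `ξⱼ`, `j > m`: this puts `m` into the
block with maximum `j`. The inner product forces equal indices; the number of copies `[c j]_q` is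
absorbed by the normalization (`annihilation_word`); and the factor `q` to the number of letters
jumped over counts the points `i < m` whose block maximum lies strictly between `m` and `j`, which
are right reduced crossings (`crossings_snoc`).

Hence `wordMoment` and `blockSum`, a weighted count of partial partitions encoded by the map from
points to block maxima, obey the same recursion (`wordMoment_succ`, `blockSum_succ`). Complete maps
of this kind are exactly the partitions below the kernel of the index function. -/

theorem creationHom_tprod (ξ : H) (n : ℕ) (m : Fin n → H) :
    creationHom ξ n (PiTensorProduct.tprod ℂ m) = PiTensorProduct.tprod ℂ (Fin.cons ξ m) := by
  simp [creationHom]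

theorem annihilationHom_tprod (q : ℝ) (ξ : H) (n : ℕ) (m : Fin (n + 1) → H) :
    annihilationHom q ξ n (PiTensorProduct.tprod ℂ m)
      = ∑ k : Fin (n + 1), ((q : ℂ) ^ (k : ℕ)) • inner ℂ ξ (m k) •
        PiTensorProduct.tprod ℂ (k.removeNth m) := by
  simp [annihilationHom]

theorem removeNth_succ_cons {α : Type*} {n : ℕ} (k : Fin (n + 1)) (a : α) (m : Fin (n + 1) → α) :
    (k.succ.removeNth (Fin.cons a m : Fin (n + 2) → α) : Fin (n + 1) → α)
      = Fin.cons a (k.removeNth m) := by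
  funext i
  cases i using Fin.cases <;> simp [Fin.removeNth]

theorem annihilationHom_creationHom_zero (q : ℝ) (ξ η : H) :
    annihilationHom q ξ 0 ∘ₗ creationHom η 0 = (inner ℂ ξ η : ℂ) • LinearMap.id := by
  ext m
  simp [creationHom_tprod, annihilationHom_tprod]

/-- Removing the new first letter gives the inner product; every other letter has moved one place to
the right, which costs one more factor `q`. -/
theorem annihilationHom_creationHom_succ (q : ℝ) (ξ η : H) (n : ℕ) :
    annihilationHom q ξ (n + 1) ∘ₗ creationHom η (n + 1)
      = (inner ℂ ξ η : ℂ) • LinearMap.id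
        + (q : ℂ) • (creationHom η n ∘ₗ annihilationHom q ξ n) := by
  ext m
  simp only [LinearMap.compMultilinearMap_apply, LinearMap.comp_apply, creationHom_tprod,
    annihilationHom_tprod, LinearMap.add_apply, LinearMap.smul_apply, LinearMap.id_apply, map_sum,
    map_smul]
  rw [Fin.sum_univ_succ, Finset.smul_sum]
  congr 1
  · simp
  · refine Finset.sum_congr rfl fun k _ => ?_
    rw [removeNth_succ_cons, Fin.cons_succ, smul_smul (q : ℂ), Fin.val_succ, pow_succ']

/-- The `q`-commutation relation. -/
theorem annihilation_creation (q : ℝ) (ξ η : H) (x : FormalFock H) :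
    annihilation q ξ (creation η x)
      = (inner ℂ ξ η : ℂ) • x + (q : ℂ) • creation η (annihilation q ξ x) := by
  funext n
  cases n with
  | zero =>
    have := LinearMap.congr_fun (annihilationHom_creationHom_zero q ξ η) (x 0)
    refine this.trans ?_
    change _ = (inner ℂ ξ η : ℂ) • x 0 + (q : ℂ) • (0 : ⨂[ℂ]^0 H)
    simp
  | succ n => exact LinearMap.congr_fun (annihilationHom_creationHom_succ q ξ η n) (x (n + 1))

theorem qNumber_succ (q : ℝ) (n : ℕ) : qNumber q (n + 1) = 1 + q * qNumber q n := by
  rw [qNumber, qNumber, Finset.sum_range_succ', Finset.mul_sum, add_comm]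
  simp [pow_succ']

/-- For negative `q` this is the closed form `(1 - q^{n+1}) / (1 - q)` with `|q| < 1`. It makes
division by `[k]_q!` legitimate. -/
theorem qNumber_pos {q : ℝ} (hq : -1 < q) (n : ℕ) : 0 < qNumber q (n + 1) := by
  rcases le_or_gt 0 q with h | h
  · rw [qNumber, Finset.sum_range_succ']
    have : 0 ≤ ∑ k ∈ Finset.range n, q ^ (k + 1) := Finset.sum_nonneg fun _ _ => by positivity
    simp only [pow_zero]
    linarith
  · have h1 : (1 - q) * qNumber q (n + 1) = 1 - q ^ (n + 1) := mul_neg_geom_sum q (n + 1)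
    have h2 : |q ^ (n + 1)| < 1 := by
      rw [abs_pow]
      exact pow_lt_one₀ (abs_nonneg q) (abs_lt.2 ⟨hq, by linarith⟩) n.succ_ne_zero
    have h3 := (abs_lt.1 h2).2
    exact (mul_pos_iff_of_pos_left (by linarith : 0 < 1 - q)).1 (by linarith)

theorem qFactorial_succ (q : ℝ) (n : ℕ) :
    qFactorial q (n + 1) = qFactorial q n * qNumber q (n + 1) := by
  simp [qFactorial, Finset.prod_range_succ]

theorem qFactorial_ne_zero {q : ℝ} (hq : -1 < q) (n : ℕ) : qFactorial q n ≠ 0 :=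
  Finset.prod_ne_zero_iff.2 fun i _ => (qNumber_pos hq i).ne'

/-- Jumping over successive letters costs `1, q, …, q^{k-1}`, which add up to `[k]_q`. At `k = 0`
the truncated exponent `k - 1` is harmless because `[0]_q = 0`. -/
theorem annihilation_creation_pow (q : ℝ) (ξ η : H) (k : ℕ) (x : FormalFock H) :
    annihilation q ξ ((creation η ^ k) x)
      = ((qNumber q k : ℂ) * inner ℂ ξ η) • (creation η ^ (k - 1)) x
        + ((q : ℂ) ^ k) • (creation η ^ k) (annihilation q ξ x) := by
  induction k with
  | zero => simp [qNumber]
  | succ k ih =>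
    rw [pow_succ', Module.End.mul_apply, annihilation_creation, ih, qNumber_succ]
    cases k with
    | zero => simp [qNumber]
    | succ k =>
      simp only [Nat.add_sub_cancel, map_add, map_smul, Module.End.mul_apply, pow_succ']
      push_cast
      module

theorem annihilation_vacuum (q : ℝ) (ξ : H) : annihilation q ξ (vacuum H) = 0 := by
  funext n
  change annihilationHom q ξ n (vacuum H (n + 1)) = 0
  simp [vacuum]

/-- The vacuum component of a formal sum. -/
def vacuumCoeff (q : ℝ) : FormalFock H →ₗ[ℂ] ℂ :=
  tensorInner (Fin.elim0 : Fin 0 → H) ∘ₗ qSymmetrizator H q 0 ∘ₗ LinearMap.proj 0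

theorem vacuumExpectation_eq (q : ℝ) (X : Module.End ℂ (FormalFock H)) :
    vacuumExpectation q X = vacuumCoeff q (X (vacuum H)) := rfl

theorem vacuumCoeff_vacuum (q : ℝ) : vacuumCoeff q (vacuum H) = 1 := by
  simp [vacuumCoeff, vacuum, tensorInner, qSymmetrizator, inversions]

theorem vacuumCoeff_creation (q : ℝ) (ξ : H) (x : FormalFock H) :
    vacuumCoeff q (creation ξ x) = 0 := by
  have : creation ξ x 0 = 0 := rfl
  simp [vacuumCoeff, this]

/-! ### Truncating the formal series by degree -/

theorem creation_congr {m : ℕ} {x y : FormalFock H} (ξ : H) (h : ∀ d ≤ m, x d = y d) :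
    ∀ d ≤ m, creation ξ x d = creation ξ y d
  | 0, _ => rfl
  | d + 1, hd => congrArg (creationHom ξ d) (h d (Nat.le_of_succ_le hd))

theorem creation_pow_congr {m : ℕ} {x y : FormalFock H} (ξ : H) (h : ∀ d ≤ m, x d = y d) (k : ℕ) :
    ∀ d ≤ m, (creation ξ ^ k) x d = (creation ξ ^ k) y d := by
  induction k with
  | zero => exact h
  | succ k ih => rw [pow_succ']; exact creation_congr ξ ih

/-- Annihilation lowers the degree by exactly one and the series never lowers it. -/
theorem toeplitz_congr {m : ℕ} {x y : FormalFock H} (q : ℝ) (α : ℕ → ℂ) (ξ : H)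
    (h : ∀ d ≤ m + 1, x d = y d) :
    ∀ d ≤ m, toeplitz q α ξ x d = toeplitz q α ξ y d := by
  intro d hd
  have h1 : annihilation q ξ x d = annihilation q ξ y d :=
    congrArg (annihilationHom q ξ d) (h (d + 1) (by omega))
  have h2 (c : ℕ → ℂ) : creationSeries c ξ x d = creationSeries c ξ y d := by
    simp only [creationSeries, LinearMap.pi_apply, LinearMap.sum_apply, LinearMap.smul_apply,
      LinearMap.comp_apply, LinearMap.proj_apply]
    exact Finset.sum_congr rfl fun k _ => by
      rw [creation_pow_congr (m := d) ξ (fun d' hd' => h d' (by omega)) k d le_rfl]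
  simp only [toeplitz, LinearMap.add_apply, Pi.add_apply, h1, h2]

/-- In degrees at most `m`, a power series in a creation operator agrees with its partial sum. -/
theorem creationSeries_apply_of_le (c : ℕ → ℂ) (ξ : H) (x : FormalFock H) {m d : ℕ} (hd : d ≤ m) :
    creationSeries c ξ x d = (∑ k ∈ Finset.range (m + 1), c k • (creation ξ ^ k) x) d := by
  simp only [creationSeries, LinearMap.pi_apply, LinearMap.sum_apply, LinearMap.smul_apply,
      LinearMap.comp_apply, LinearMap.proj_apply, Finset.sum_apply, Pi.smul_apply]
  refine Finset.sum_subset (Finset.range_mono (by omega)) fun k _ hk => ?_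
  rw [creation_pow_apply_of_lt ξ x (by simpa using hk), smul_zero]

/-- The product `T(ξ₀) ⋯ T(ξ_{m-1})`. -/
def toeplitzProd (q : ℝ) (α : ℕ → ℂ) (ξ : ℕ → H) : ℕ → Module.End ℂ (FormalFock H)
  | 0 => 1
  | m + 1 => toeplitzProd q α ξ m * toeplitz q α (ξ m)

theorem prod_ofFn_toeplitz (q : ℝ) (α : ℕ → ℂ) (ξ : ℕ → H) (m : ℕ) :
    (List.ofFn fun i : Fin m => toeplitz q α (ξ i)).prod = toeplitzProd q α ξ m := by
  induction m with
  | zero => simp [toeplitzProd]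
  | succ m ih =>
    rw [List.ofFn_succ', List.concat_eq_append, List.prod_append]
    simp [ih, toeplitzProd]

/-- With `m` factors left, components of degree above `m` cannot return to the vacuum, so a power
series may be cut off at exponent `m`. -/
theorem vacuumCoeff_toeplitzProd_congr (q : ℝ) (α : ℕ → ℂ) (ξ : ℕ → H) (m : ℕ)
    {x y : FormalFock H} (h : ∀ d ≤ m, x d = y d) :
    vacuumCoeff q (toeplitzProd q α ξ m x) = vacuumCoeff q (toeplitzProd q α ξ m y) := by
  induction m generalizing x y with
  | zero => simp [toeplitzProd, vacuumCoeff, h 0 le_rfl]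
  | succ m ih => exact ih (toeplitz_congr q α (ξ m) h)

/-! ### Action on normalized words and the recursion for moments -/

/-- The normalized word
`∏_{p ≤ j < p + l} (ξⱼ^{⊗ c j} / [c j]_q!)`. -/
def word (q : ℝ) (ξ : ℕ → H) (c : ℕ → ℕ) : ℕ → ℕ → FormalFock H
  | _, 0 => vacuum H
  | p, l + 1 => ((qFactorial q (c p) : ℂ)⁻¹) • (creation (ξ p) ^ c p) (word q ξ c (p + 1) l)

theorem word_congr (q : ℝ) (ξ : ℕ → H) {c c' : ℕ → ℕ} (p l : ℕ) (h : ∀ j, p ≤ j → c j = c' j) :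
    word q ξ c p l = word q ξ c' p l := by
  induction l generalizing p with
  | zero => rfl
  | succ l ih => simp only [word, h p le_rfl, ih (p + 1) fun j hj => h j (by omega)]

theorem vacuumCoeff_word (q : ℝ) (ξ : ℕ → H) (c : ℕ → ℕ) (p l : ℕ) :
    vacuumCoeff q (word q ξ c p l) = if ∀ j ∈ Finset.Ico p (p + l), c j = 0 then 1 else 0 := by
  induction l generalizing p with
  | zero => simp [word, vacuumCoeff_vacuum]
  | succ l ih =>
    rw [word, map_smul]
    have hI : Finset.Ico p (p + (l + 1)) = insert p (Finset.Ico (p + 1) (p + 1 + l)) := by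
      rw [Finset.insert_Ico_add_one_left_eq_Ico (by omega)]; congr 1; omega
    rw [hI]
    simp only [Finset.forall_mem_insert]
    rcases hc : c p with _ | k
    · rw [pow_zero, Module.End.one_apply, ih]
      simpa [qFactorial] using if_congr (by simp) rfl rfl
    · simp [pow_succ', vacuumCoeff_creation]

/-- The normalization turns the coefficient `[c j]_q` of a letter removed from the `j`-th group into
`1`; only the power of `q` from the earlier groups survives. -/
theorem annihilation_word {q : ℝ} (hq : -1 < q) (η : H) (ξ : ℕ → H) (c : ℕ → ℕ) (p l : ℕ) :
    annihilation q η (word q ξ c p l)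
      = ∑ j ∈ Finset.Ico p (p + l),
          (if 0 < c j then inner ℂ η (ξ j) * (q : ℂ) ^ (∑ i ∈ Finset.Ico p j, c i) else 0) •
            word q ξ (Function.update c j (c j - 1)) p l := by
  induction l generalizing p with
  | zero => simp [word, annihilation_vacuum]
  | succ l ih =>
    rw [word, map_smul, annihilation_creation_pow, ih,
      Finset.sum_eq_sum_Ico_succ_bot (by omega : p < p + (l + 1)), smul_add]
    have hl : p + (l + 1) = p + 1 + l := by omega
    congr 1
    -- A letter of the first group is removed: `[k+1]_q / [k+1]_q! = 1 / [k]_q!`.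
    · rcases hc : c p with _ | k
      · simp [qNumber]
      · have h1 : (qFactorial q k : ℂ) ≠ 0 := by exact_mod_cast qFactorial_ne_zero hq k
        have h2 : (qNumber q (k + 1) : ℂ) ≠ 0 := by exact_mod_cast (qNumber_pos hq k).ne'
        have h3 : word q ξ (Function.update c p k) (p + 1) l = word q ξ c (p + 1) l :=
          word_congr q ξ _ _ fun j hj => Function.update_of_ne (by omega) _ _
        simp only [word, Nat.add_sub_cancel, Nat.succ_pos, if_true, Finset.Ico_self,
          Finset.sum_empty, pow_zero, mul_one, Function.update_self, h3, qFactorial_succ, smul_smul]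
        congr 1
        push_cast
        field_simp
    -- The whole first group is jumped over, contributing `q ^ c p`.
    · rw [hl, map_sum, Finset.smul_sum, Finset.smul_sum]
      refine Finset.sum_congr rfl fun j hj => ?_
      rw [Finset.mem_Ico] at hj
      rw [word, Function.update_of_ne (by omega : p ≠ j), map_smul]
      simp only [smul_smul]
      split_ifs with h0
      · congr 1
        rw [Finset.sum_eq_sum_Ico_succ_bot (by omega : p < j), pow_add]
        ring
      · simp

/-- The matrix coefficient of `T(ξ₀) ⋯ T(ξ_{m-1})` between the vacuum and a normalized word. -/
def wordMoment (q : ℝ) (α : ℕ → ℂ) (ξ : ℕ → H) (n m : ℕ) (c : ℕ → ℕ) : ℂ :=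
  vacuumCoeff q (toeplitzProd q α ξ m (word q ξ c m (n - m)))

theorem wordMoment_zero (q : ℝ) (α : ℕ → ℂ) (ξ : ℕ → H) (n : ℕ) (c : ℕ → ℕ) :
    wordMoment q α ξ n 0 c = if ∀ j < n, c j = 0 then 1 else 0 := by
  rw [wordMoment, toeplitzProd, Module.End.one_apply, vacuumCoeff_word]
  simp

/-- The two sums are the series and annihilation parts of the factor `T(ξₘ)`. Entries of `c` below
the start of the word play no role, so the value at `m` is overwritten: by `k` for new letters, by
`0` after an annihilation. -/
theorem wordMoment_succ {q : ℝ} (hq : -1 < q) (α : ℕ → ℂ) (ξ : ℕ → H) {n m : ℕ} (hm : m < n)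
    (c : ℕ → ℕ) :
    wordMoment q α ξ n (m + 1) c
      = ∑ k ∈ Finset.range (m + 1), α (k + 1) * wordMoment q α ξ n m (Function.update c m k)
        + ∑ j ∈ Finset.Ico (m + 1) n,
            (if 0 < c j then
              inner ℂ (ξ m) (ξ j) * (q : ℂ) ^ (∑ i ∈ Finset.Ico (m + 1) j, c i) else 0) *
            wordMoment q α ξ n m (Function.update (Function.update c m 0) j (c j - 1)) := by
  have hn : n - m = n - (m + 1) + 1 := by omega
  have hn' : m + 1 + (n - (m + 1)) = n := by omega
  rw [wordMoment, toeplitzProd, Module.End.mul_apply, toeplitz, LinearMap.add_apply, map_add,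
    map_add, add_comm]
  congr 1
  · rw [vacuumCoeff_toeplitzProd_congr q α ξ m fun d hd => creationSeries_apply_of_le _ _ _ hd,
      map_sum, map_sum]
    refine Finset.sum_congr rfl fun k _ => ?_
    have h3 : word q ξ (Function.update c m k) (m + 1) (n - (m + 1))
        = word q ξ c (m + 1) (n - (m + 1)) :=
      word_congr q ξ _ _ fun j hj => Function.update_of_ne (by omega) _ _
    rw [wordMoment, hn, word, h3]
    simp only [map_smul, smul_eq_mul, Function.update_self]
    ring
  · rw [annihilation_word hq, hn', map_sum, map_sum]
    refine Finset.sum_congr rfl fun j hj => ?_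
    rw [Finset.mem_Ico] at hj
    rw [map_smul, map_smul, smul_eq_mul, wordMoment, hn, word,
      Function.update_of_ne (by omega : m ≠ j), Function.update_self]
    congr 3
    simp only [qFactorial, Finset.range_zero, Finset.prod_empty, Complex.ofReal_one, inv_one,
      pow_zero, Module.End.one_apply, one_smul]
    refine word_congr q ξ _ _ fun i hi => ?_
    simp only [Function.update_apply]
    split_ifs <;> first | rfl | omega


/-! ### Partial partitions encoded by block maxima, with the same recursion -/

/-- The size of the fiber of `g` over `j`. -/
def fiberCard {m : ℕ} (g : Fin m → ℕ) (j : ℕ) : ℕ := (Finset.univ.filter fun i => g i = j).card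

/-- `g` sends every point to the largest point of its block, for a partition into blocks on which
`h` is constant; the largest point need not be in the domain of `g`. -/
def IsBlockMax (h : ℕ → ℕ) {m : ℕ} (g : Fin m → ℕ) : Prop :=
  ∀ i : Fin m, (i : ℕ) ≤ g i ∧ h (g i) = h i ∧ ∀ i' : Fin m, (i' : ℕ) = g i → g i' = g i

/-- The number of pairs `i < i'` with `i' < g i < g i'`. -/
def crossings {m : ℕ} (g : Fin m → ℕ) : ℕ :=
  (Finset.univ.filter fun p : Fin m × Fin m => p.1 < p.2 ∧ p.2 < g p.1 ∧ g p.1 < g p.2).card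

/-- The weight `q^{rrc} ∏_B α_{|B|}`, in terms of the map to the largest points of the blocks. -/
def blockWeight (q : ℝ) (α : ℕ → ℂ) {m : ℕ} (g : Fin m → ℕ) : ℂ :=
  (q : ℂ) ^ crossings g * ∏ i : Fin m, if g i = i then α (fiberCard g (g i)) else 1

theorem fiberCard_snoc {m : ℕ} (g : Fin m → ℕ) (a j : ℕ) :
    fiberCard (Fin.snoc g a : Fin (m + 1) → ℕ) j = fiberCard g j + if a = j then 1 else 0 := by
  simp [fiberCard, Finset.card_filter, -Finset.sum_boole, Fin.sum_univ_castSucc]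

theorem fiberCard_eq_zero {m : ℕ} (g : Fin m → ℕ) (j : ℕ) :
    fiberCard g j = 0 ↔ ∀ i, g i ≠ j := by
  simp [fiberCard, Finset.filter_eq_empty_iff]

theorem fiberCard_le {m : ℕ} (g : Fin m → ℕ) (j : ℕ) : fiberCard g j ≤ m :=
  (Finset.card_filter_le _ _).trans (by simp)

theorem isBlockMax_snoc {h : ℕ → ℕ} {m : ℕ} {g : Fin m → ℕ} {a : ℕ} :
    IsBlockMax h (Fin.snoc g a : Fin (m + 1) → ℕ)
      ↔ IsBlockMax h g ∧ m ≤ a ∧ h a = h m ∧ ∀ i, g i = m → a = m := by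
  simp only [IsBlockMax, Fin.forall_fin_succ', Fin.snoc_castSucc, Fin.snoc_last, Fin.val_castSucc,
    Fin.val_last]
  constructor
  · rintro ⟨h1, h2⟩
    refine ⟨fun i => ⟨(h1 i).1, (h1 i).2.1, (h1 i).2.2.1⟩, h2.1, h2.2.1, fun i hi => ?_⟩
    exact ((h1 i).2.2.2 hi.symm).trans hi
  · rintro ⟨h1, h2, h3, h4⟩
    refine ⟨fun i => ⟨(h1 i).1, (h1 i).2.1, (h1 i).2.2, fun hi => ?_⟩, h2, h3, fun i hi => ?_,
      fun _ => trivial⟩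
    · exact (h4 i hi.symm).trans hi
    · have := i.isLt
      omega

theorem card_filter_between {m : ℕ} (g : Fin m → ℕ) (a b : ℕ) :
    (Finset.univ.filter fun i => a < g i ∧ g i < b).card
      = ∑ j ∈ Finset.Ico (a + 1) b, fiberCard g j := by
  rw [Finset.card_eq_sum_card_fiberwise (f := g) (t := Finset.Ico (a + 1) b)]
  · refine Finset.sum_congr rfl fun j hj => ?_
    rw [Finset.mem_Ico] at hj
    rw [fiberCard, Finset.filter_filter]
    congr 1
    ext i
    simp only [Finset.mem_filter, Finset.mem_univ, true_and]
    omega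
  · intro i hi
    simpa [Nat.succ_le_iff] using hi

/-- The new point `m` exceeds all others, so it can only be the second point of a pair; its partners
are the `i` with `m < g i < a`. -/
theorem crossings_snoc {m : ℕ} (g : Fin m → ℕ) (a : ℕ) :
    crossings (Fin.snoc g a : Fin (m + 1) → ℕ)
      = crossings g + ∑ j ∈ Finset.Ico (m + 1) a, fiberCard g j := by
  rw [← card_filter_between]
  have h (i : Fin m) : ¬ Fin.last m < i.castSucc := not_lt.2 (Fin.le_last _)
  simp [crossings, Finset.card_filter, -Finset.sum_boole, Fintype.sum_prod_type, Fin.sum_univ_castSucc,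
    Finset.sum_add_distrib, h]

theorem blockWeight_snoc_self (q : ℝ) (α : ℕ → ℂ) {m : ℕ} (g : Fin m → ℕ) :
    blockWeight q α (Fin.snoc g m : Fin (m + 1) → ℕ)
      = α (fiberCard g m + 1) * blockWeight q α g := by
  rw [blockWeight, blockWeight, crossings_snoc, Fin.prod_univ_castSucc]
  simp only [Fin.snoc_castSucc, Fin.snoc_last, fiberCard_snoc, Fin.val_castSucc, Fin.val_last,
    if_true]
  have : ∀ i : Fin m, (if g i = i then α (fiberCard g (g i) + if m = g i then 1 else 0) else 1)
      = if g i = i then α (fiberCard g (g i)) else 1 := fun i => by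
    have := i.isLt
    split_ifs <;> first | rfl | omega
  simp only [this, Finset.Ico_eq_empty_of_le (Nat.le_succ m), Finset.sum_empty, add_zero]
  ring

theorem blockWeight_snoc_of_lt (q : ℝ) (α : ℕ → ℂ) {m a : ℕ} (ha : m < a) (g : Fin m → ℕ) :
    blockWeight q α (Fin.snoc g a : Fin (m + 1) → ℕ)
      = (q : ℂ) ^ (∑ j ∈ Finset.Ico (m + 1) a, fiberCard g j) * blockWeight q α g := by
  rw [blockWeight, blockWeight, crossings_snoc, Fin.prod_univ_castSucc]
  simp only [Fin.snoc_castSucc, Fin.snoc_last, fiberCard_snoc, Fin.val_castSucc, Fin.val_last,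
    if_neg ha.ne']
  have : ∀ i : Fin m, (if g i = i then α (fiberCard g (g i) + if a = g i then 1 else 0) else 1)
      = if g i = i then α (fiberCard g (g i)) else 1 := fun i => by
    have := i.isLt
    split_ifs <;> first | rfl | omega
  simp only [this]
  ring

open scoped Classical in
/-- The weight of `g`, if `g` describes blocks with `c j` points in its domain for every largest
point `j ≥ m`, and zero otherwise. -/
def blockTerm (q : ℝ) (α : ℕ → ℂ) (h : ℕ → ℕ) (n : ℕ) (c : ℕ → ℕ) {m : ℕ} (g : Fin m → ℕ) : ℂ :=
  if IsBlockMax h g ∧ ∀ j, m ≤ j → j < n → fiberCard g j = c j then blockWeight q α g else 0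

theorem blockTerm_snoc_of_lt (q : ℝ) (α : ℕ → ℂ) (h : ℕ → ℕ) (n : ℕ) (c : ℕ → ℕ) {m a : ℕ}
    (ha : a < m) (g : Fin m → ℕ) :
    blockTerm q α h n c (Fin.snoc g a : Fin (m + 1) → ℕ) = 0 := by
  rw [blockTerm, if_neg]
  rw [isBlockMax_snoc]
  omega

theorem blockTerm_snoc_self (q : ℝ) (α : ℕ → ℂ) (h : ℕ → ℕ) {n m : ℕ} (hm : m < n) (c : ℕ → ℕ)
    (g : Fin m → ℕ) :
    blockTerm q α h n c (Fin.snoc g m : Fin (m + 1) → ℕ)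
      = ∑ k ∈ Finset.range (m + 1), α (k + 1) * blockTerm q α h n (Function.update c m k) g := by
  -- Given `g`, only one `k` survives: the number of earlier points already sent to `m`.
  rw [Finset.sum_eq_single (fiberCard g m)]
  · rw [blockTerm, blockTerm, blockWeight_snoc_self, mul_ite, mul_zero]
    classical
    apply if_congr _ rfl rfl
    rw [isBlockMax_snoc]
    constructor
    · rintro ⟨h1, h2⟩
      refine ⟨h1.1, fun j hj hjn => ?_⟩
      rcases eq_or_lt_of_le hj with rfl | hj'
      · simp
      · rw [Function.update_of_ne hj'.ne', ← h2 j hj' hjn, fiberCard_snoc, if_neg hj'.ne, add_zero]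
    · rintro ⟨h1, h2⟩
      refine ⟨⟨h1, le_rfl, rfl, fun _ _ => rfl⟩, fun j hj hjn => ?_⟩
      have hj' : m < j := hj
      rw [fiberCard_snoc, if_neg hj'.ne, add_zero, h2 j hj'.le hjn, Function.update_of_ne hj'.ne']
  · intro k _ hk
    rw [blockTerm, if_neg, mul_zero]
    rintro ⟨-, h2⟩
    exact hk (by simpa using (h2 m le_rfl hm).symm)
  · intro hk
    exact absurd (Finset.mem_range_succ_iff.2 (fiberCard_le g m)) hk

/-- Since `m` is not its own maximum, no earlier point may have maximum `m`: this is the entry `0`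
at `m`. The fiber over `a` loses the point `m`. -/
theorem blockTerm_snoc_of_gt (q : ℝ) (α : ℕ → ℂ) (h : ℕ → ℕ) {n m a : ℕ} (ha : m < a) (han : a < n)
    (c : ℕ → ℕ) (g : Fin m → ℕ) :
    blockTerm q α h n c (Fin.snoc g a : Fin (m + 1) → ℕ)
      = (if 0 < c a then
          (if h m = h a then 1 else 0) * (q : ℂ) ^ (∑ i ∈ Finset.Ico (m + 1) a, c i) else 0) *
        blockTerm q α h n (Function.update (Function.update c m 0) a (c a - 1)) g := by
  have key : (IsBlockMax h (Fin.snoc g a : Fin (m + 1) → ℕ) ∧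
        ∀ j, m + 1 ≤ j → j < n → fiberCard (Fin.snoc g a : Fin (m + 1) → ℕ) j = c j)
      ↔ 0 < c a ∧ h m = h a ∧ IsBlockMax h g ∧ ∀ j, m ≤ j → j < n →
        fiberCard g j = Function.update (Function.update c m 0) a (c a - 1) j := by
    simp only [isBlockMax_snoc, fiberCard_snoc]
    constructor
    · rintro ⟨⟨h1, -, h3, h4⟩, h5⟩
      have h6 := h5 a ha han
      rw [if_pos rfl] at h6
      refine ⟨by omega, h3.symm, h1, fun j hj hjn => ?_⟩
      rcases eq_or_lt_of_le hj with rfl | hj'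
      · rw [Function.update_of_ne ha.ne, Function.update_self, fiberCard_eq_zero]
        exact fun i hi => ha.ne' (h4 i hi)
      · have h7 := h5 j hj' hjn
        simp only [Function.update_apply]
        split_ifs with h8 h9
        · subst h8; omega
        · omega
        · rw [if_neg (Ne.symm h8)] at h7; omega
    · rintro ⟨h1, h2, h3, h4⟩
      have h5 := h4 m le_rfl (by omega)
      rw [Function.update_of_ne ha.ne, Function.update_self, fiberCard_eq_zero] at h5
      refine ⟨⟨h3, ha.le, h2.symm, fun i hi => absurd hi (h5 i)⟩, fun j hj hjn => ?_⟩
      rw [h4 j (by omega) hjn]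
      simp only [Function.update_apply]
      split_ifs <;> first | omega | (subst_vars; omega)
  rw [blockTerm, blockTerm]
  by_cases hc : 0 < c a ∧ h m = h a ∧ IsBlockMax h g ∧ ∀ j, m ≤ j → j < n →
        fiberCard g j = Function.update (Function.update c m 0) a (c a - 1) j
  · rw [if_pos (key.2 hc), if_pos hc.1, if_pos hc.2.1, if_pos hc.2.2, one_mul,
      blockWeight_snoc_of_lt q α ha]
    congr 2
    refine Finset.sum_congr rfl fun j hj => ?_
    rw [Finset.mem_Ico] at hj
    rw [hc.2.2.2 j (by omega) (by omega), Function.update_of_ne (by omega),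
      Function.update_of_ne (by omega)]
  · rw [if_neg (mt key.1 hc)]
    split_ifs with h1 h2 h3 <;> simp_all

/-- The sum of the weights of all partial partitions with prescribed open blocks. -/
def blockSum (q : ℝ) (α : ℕ → ℂ) (h : ℕ → ℕ) (n m : ℕ) (c : ℕ → ℕ) : ℂ :=
  ∑ f : Fin m → Fin n, blockTerm q α h n c fun i => f i

theorem blockSum_zero (q : ℝ) (α : ℕ → ℂ) (h : ℕ → ℕ) (n : ℕ) (c : ℕ → ℕ) :
    blockSum q α h n 0 c = if ∀ j < n, c j = 0 then 1 else 0 := by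
  simp only [blockSum, Finset.univ_unique, Finset.sum_singleton, blockTerm]
  classical
  apply if_congr _ _ rfl
  · simp [IsBlockMax, fiberCard, eq_comm]
  · simp [blockWeight, crossings]

theorem blockSum_succ (q : ℝ) (α : ℕ → ℂ) (h : ℕ → ℕ) {n m : ℕ} (hm : m < n) (c : ℕ → ℕ) :
    blockSum q α h n (m + 1) c
      = ∑ k ∈ Finset.range (m + 1), α (k + 1) * blockSum q α h n m (Function.update c m k)
        + ∑ j ∈ Finset.Ico (m + 1) n,
            (if 0 < c j then
              (if h m = h j then 1 else 0) * (q : ℂ) ^ (∑ i ∈ Finset.Ico (m + 1) j, c i) else 0) *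
            blockSum q α h n m (Function.update (Function.update c m 0) j (c j - 1)) := by
  have hs (f : Fin m → Fin n) (a : Fin n) :
      (fun i => ((Fin.snoc f a : Fin (m + 1) → Fin n) i : ℕ))
        = (Fin.snoc (fun i => (f i : ℕ)) (a : ℕ) : Fin (m + 1) → ℕ) :=
    funext fun i => by cases i using Fin.lastCases <;> simp
  have hf (f : Fin m → Fin n) :
      ∑ a : Fin n, blockTerm q α h n c
          (fun i => ((Fin.snoc f a : Fin (m + 1) → Fin n) i : ℕ))
        = ∑ k ∈ Finset.range (m + 1),
            α (k + 1) * blockTerm q α h n (Function.update c m k) (fun i => (f i : ℕ))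
          + ∑ j ∈ Finset.Ico (m + 1) n,
            (if 0 < c j then
              (if h m = h j then 1 else 0) * (q : ℂ) ^ (∑ i ∈ Finset.Ico (m + 1) j, c i) else 0) *
            blockTerm q α h n (Function.update (Function.update c m 0) j (c j - 1))
              (fun i => (f i : ℕ)) := by
    simp only [hs]
    -- The image `a` of the last point is split into `a < m` (impossible), `a = m` (block maximum)
    -- and `a > m`.
    rw [Fin.sum_univ_eq_sum_range (fun a => blockTerm q α h n c
      (Fin.snoc (fun i => (f i : ℕ)) a : Fin (m + 1) → ℕ)), Finset.range_eq_Ico,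
      ← Finset.sum_Ico_consecutive _ (Nat.zero_le m) hm.le,
      Finset.sum_eq_zero fun a ha => blockTerm_snoc_of_lt q α h n c (Finset.mem_Ico.1 ha).2 _,
      zero_add, Finset.sum_eq_sum_Ico_succ_bot hm, blockTerm_snoc_self q α h hm]
    congr 1
    refine Finset.sum_congr rfl fun j hj => ?_
    rw [Finset.mem_Ico] at hj
    exact blockTerm_snoc_of_gt q α h hj.1 hj.2 c _
  rw [blockSum, ← (Fin.snocEquiv fun _ => Fin n).sum_comp, Fintype.sum_prod_type_right]
  simp only [Fin.snocEquiv, Equiv.coe_fn_mk]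
  rw [Finset.sum_congr rfl fun f _ => hf f, Finset.sum_add_distrib, Finset.sum_comm,
    Finset.sum_comm (s := Finset.univ)]
  simp only [blockSum, Finset.mul_sum]

theorem wordMoment_eq_blockSum {e : ℕ → H} (he : Orthonormal ℂ e) {q : ℝ} (hq : -1 < q)
    (α : ℕ → ℂ) (h : ℕ → ℕ) {n m : ℕ} (hm : m ≤ n) (c : ℕ → ℕ) :
    wordMoment q α (fun i => e (h i)) n m c = blockSum q α h n m c := by
  induction m generalizing c with
  | zero => rw [wordMoment_zero, blockSum_zero]
  | succ m ih =>
    rw [wordMoment_succ hq α _ hm, blockSum_succ q α h hm]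
    simp only [ih (Nat.le_of_succ_le hm), orthonormal_iff_ite.1 he]


/-! ### Set partitions and their block maximum maps -/

section Partitions

variable {n : ℕ}

/-- The largest element of the block of `i`. -/
def blockMax (π : SetPartition n) (i : Fin n) : Fin n :=
  (π.part i).max' ⟨i, π.mem_part (Finset.mem_univ i)⟩

theorem blockMax_mem_part (π : SetPartition n) (i : Fin n) : blockMax π i ∈ π.part i :=
  Finset.max'_mem _ _

theorem le_blockMax_of_mem (π : SetPartition n) {i j : Fin n} (h : j ∈ π.part i) :
    j ≤ blockMax π i :=
  Finset.le_max' _ _ h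

theorem le_blockMax (π : SetPartition n) (i : Fin n) : i ≤ blockMax π i :=
  le_blockMax_of_mem π (π.mem_part (Finset.mem_univ i))

theorem blockMax_eq_iff (π : SetPartition n) (i j : Fin n) :
    blockMax π i = blockMax π j ↔ i ∈ π.part j := by
  rw [π.mem_part_iff_part_eq_part (Finset.mem_univ i) (Finset.mem_univ j)]
  constructor
  · intro h
    have hi := blockMax_mem_part π i
    rw [h] at hi
    exact π.eq_of_mem_parts (π.part_mem.2 (Finset.mem_univ i))
      (π.part_mem.2 (Finset.mem_univ j)) hi (blockMax_mem_part π j)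
  · intro h
    simp only [blockMax]
    congr 1

theorem blockMax_blockMax (π : SetPartition n) (i : Fin n) :
    blockMax π (blockMax π i) = blockMax π i :=
  (blockMax_eq_iff π _ _).2 (blockMax_mem_part π i)

theorem isGreatest_iff_blockMax_eq (π : SetPartition n) {B : Finset (Fin n)} (hB : B ∈ π.parts)
    {i j : Fin n} (hi : i ∈ B) : IsGreatest (B : Set (Fin n)) j ↔ blockMax π i = j := by
  have hp : π.part i = B := π.part_eq_of_mem hB hi
  have : IsGreatest (B : Set (Fin n)) (blockMax π i) := by
    rw [← hp]
    exact Finset.isGreatest_max' _ _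
  exact ⟨fun h => this.unique h, fun h => h ▸ this⟩

/-- The last two entries of a right reduced crossing are the block maxima of the first two, hence
redundant. -/
theorem rrc_eq_crossings (π : SetPartition n) :
    rrc π = crossings fun i => (blockMax π i : ℕ) := by
  classical
  refine (Finset.card_nbij' (fun p => (p.1, p.2, blockMax π p.1, blockMax π p.2))
    (fun t => (t.1, t.2.1)) ?_ ?_ ?_ ?_).symm
  · rintro ⟨i, i'⟩ h
    simp only [Finset.coe_filter, Finset.mem_univ, true_and, Set.mem_ofPred_eq, Fin.val_fin_lt]
      at h ⊢
    have hB (k : Fin n) := π.part_mem.2 (Finset.mem_univ k)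
    have hm (k : Fin n) := π.mem_part (Finset.mem_univ k)
    exact ⟨h.1, h.2.1, h.2.2, _, hB i, _, hB i', hm i, hm i',
      (isGreatest_iff_blockMax_eq π (hB i) (hm i)).2 rfl,
      (isGreatest_iff_blockMax_eq π (hB i') (hm i')).2 rfl⟩
  · rintro ⟨i, i', j, j'⟩ h
    simp only [Finset.coe_filter, Finset.mem_univ, true_and, Set.mem_ofPred_eq, Fin.val_fin_lt]
      at h ⊢
    obtain ⟨h1, h2, h3, B, hB, B', hB', hi, hi', hj, hj'⟩ := h
    rw [isGreatest_iff_blockMax_eq π hB hi] at hj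
    rw [isGreatest_iff_blockMax_eq π hB' hi'] at hj'
    rw [hj, hj']
    exact ⟨h1, h2, h3⟩
  · exact fun _ _ => rfl
  · rintro ⟨i, i', j, j'⟩ h
    simp only [Finset.coe_filter, Finset.mem_univ, true_and, Set.mem_ofPred_eq] at h ⊢
    obtain ⟨h1, h2, h3, B, hB, B', hB', hi, hi', hj, hj'⟩ := h
    rw [isGreatest_iff_blockMax_eq π hB hi] at hj
    rw [isGreatest_iff_blockMax_eq π hB' hi'] at hj'
    rw [hj, hj']

theorem fiberCard_blockMax (π : SetPartition n) (i : Fin n) :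
    fiberCard (fun i => (blockMax π i : ℕ)) (blockMax π i) = (π.part i).card := by
  rw [fiberCard]
  congr 1
  ext j
  simp [Fin.val_inj, blockMax_eq_iff]

/-- Blocks correspond to their maxima, that is, to the fixed points of `blockMax π`. -/
theorem prod_parts_eq_prod_blockMax (π : SetPartition n) (α : ℕ → ℂ) :
    ∏ B ∈ π.parts, α B.card
      = ∏ i : Fin n, if (blockMax π i : ℕ) = i then
          α (fiberCard (fun i => (blockMax π i : ℕ)) (blockMax π i)) else 1 := by
  rw [← Finset.prod_filter]
  refine (Finset.prod_nbij π.part ?_ ?_ ?_ ?_).symm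
  · exact fun i _ => π.part_mem.2 (Finset.mem_univ i)
  · intro i hi j hj hij
    simp only [Finset.coe_filter, Finset.mem_univ, true_and, Set.mem_ofPred_eq, Fin.val_inj]
      at hi hj
    rw [← hi, ← hj]
    exact (blockMax_eq_iff π i j).2
      ((π.mem_part_iff_part_eq_part (Finset.mem_univ i) (Finset.mem_univ j)).2 hij)
  · intro B hB
    obtain ⟨i, hi⟩ := π.nonempty_of_mem_parts hB
    refine ⟨blockMax π i, ?_, ?_⟩
    · simp [blockMax_blockMax]
    · refine π.part_eq_of_mem hB ?_
      rw [← π.part_eq_of_mem hB hi]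
      exact blockMax_mem_part π i
  · exact fun i _ => by rw [fiberCard_blockMax]

theorem blockWeight_blockMax (q : ℝ) (α : ℕ → ℂ) (π : SetPartition n) :
    blockWeight q α (fun i => (blockMax π i : ℕ))
      = (q : ℂ) ^ rrc π * ∏ B ∈ π.parts, α B.card := by
  rw [blockWeight, rrc_eq_crossings, prod_parts_eq_prod_blockMax]

theorem blockMax_injective : Function.Injective (blockMax (n := n)) := by
  intro π π' h
  have hp (i : Fin n) : π.part i = π'.part i := by
    ext j
    rw [← blockMax_eq_iff, ← blockMax_eq_iff, h]
  ext B
  constructor <;> intro hB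
  · obtain ⟨i, hi⟩ := π.nonempty_of_mem_parts hB
    rw [← π.part_eq_of_mem hB hi, hp]
    exact π'.part_mem.2 (Finset.mem_univ i)
  · obtain ⟨i, hi⟩ := π'.nonempty_of_mem_parts hB
    rw [← π'.part_eq_of_mem hB hi, ← hp]
    exact π.part_mem.2 (Finset.mem_univ i)

/-- The partition into fibers of `f` works: idempotence puts `f i` in the fiber of `i`, and `h1`
makes it the largest element there. -/
theorem exists_blockMax_eq {f : Fin n → Fin n} (h1 : ∀ i, i ≤ f i) (h2 : ∀ i, f (f i) = f i) :
    ∃ π : SetPartition n, blockMax π = f := by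
  classical
  refine ⟨Finpartition.ofSetoid (Setoid.ker f), funext fun i => ?_⟩
  have hmem (j : Fin n) : j ∈ (Finpartition.ofSetoid (Setoid.ker f)).part i ↔ f i = f j :=
    Finpartition.mem_part_ofSetoid_iff_rel
  apply le_antisymm
  · have := (hmem _).1 (blockMax_mem_part _ i)
    rw [this]
    exact h1 _
  · exact le_blockMax_of_mem _ ((hmem _).2 (h2 i).symm)

theorem le_iff_blockNumber_blockMax (π σ : SetPartition n) :
    π ≤ σ ↔ ∀ i, blockNumber σ (blockMax π i) = blockNumber σ i := by
  constructor
  · intro h i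
    obtain ⟨C, hC, hBC⟩ := h (π.part_mem.2 (Finset.mem_univ i))
    exact (blockNumber_eq_iff σ _ _).2
      ⟨C, hC, hBC (blockMax_mem_part π i), hBC (π.mem_part (Finset.mem_univ i))⟩
  · intro h B hB
    obtain ⟨i, hi⟩ := π.nonempty_of_mem_parts hB
    refine ⟨σ.part i, σ.part_mem.2 (Finset.mem_univ i), fun j hj => ?_⟩
    rw [Finpartition.mem_part_iff_exists, ← blockNumber_eq_iff, ← h j, ← h i]
    congr 1
    rw [blockMax_eq_iff, π.part_eq_of_mem hB hi]
    exact hj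

end Partitions

/-! ### Moment formula and Möbius inversion -/

/-- The moments of the `q`-Toeplitz operators as sums over maps to the largest points of blocks. -/
theorem mixedMoment_toeplitz {e : ℕ → H} (he : Orthonormal ℂ e) {q : ℝ} (hq : -1 < q)
    (α : ℕ → ℂ) {n : ℕ} (h : Fin n → ℕ) :
    mixedMoment (vacuumExpectation q) (fun _ k => toeplitz q α (e k)) h
      = ∑ f : Fin n → Fin n with ∀ i, i ≤ f i ∧ h (f i) = h i ∧ f (f i) = f i,
          blockWeight q α fun i => (f i : ℕ) := by
  -- The recursion uses indices in `ℕ`; the value `0` beyond `n` is never seen.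
  set h' : ℕ → ℕ := fun i => if hi : i < n then h ⟨i, hi⟩ else 0 with hh
  have hv (i : Fin n) : h' i = h i := by simp [hh]
  have h1 : mixedMoment (vacuumExpectation q) (fun _ k => toeplitz q α (e k)) h
      = wordMoment q α (fun i => e (h' i)) n n 0 := by
    rw [mixedMoment, vacuumExpectation_eq, wordMoment, Nat.sub_self, word,
      ← prod_ofFn_toeplitz q α (fun i => e (h' i))]
    simp only [hv]
  rw [h1, wordMoment_eq_blockSum he hq α h' le_rfl, blockSum, Finset.sum_filter]
  refine Finset.sum_congr rfl fun f _ => ?_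
  rw [blockTerm]
  classical
  apply if_congr _ rfl rfl
  constructor
  · rintro ⟨h2, -⟩ i
    obtain ⟨h3, h4, h5⟩ := h2 i
    rw [hv, hv] at h4
    exact ⟨h3, h4, Fin.ext (h5 (f i) rfl)⟩
  · intro h2
    -- At `m = n` no open blocks remain, so the condition on fibers over `j ≥ m` is vacuous.
    refine ⟨fun i => ⟨(h2 i).1, ?_, fun i' hi' => ?_⟩, fun j hj hj' => absurd hj' hj.not_gt⟩
    · rw [hv, hv]
      exact (h2 i).2.1
    · rw [Fin.ext hi']
      exact congrArg Fin.val (h2 i).2.2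

open scoped Classical in
/-- The moment-cumulant formula for the `q`-Toeplitz operators. -/
theorem partitionedMoment_toeplitz {e : ℕ → H} (he : Orthonormal ℂ e) {q : ℝ} (hq : -1 < q)
    (α : ℕ → ℂ) {n : ℕ} (σ : SetPartition n) :
    partitionedMoment (vacuumExpectation q) (fun _ k => toeplitz q α (e k)) σ
      = ∑ π : SetPartition n with π ≤ σ, (q : ℂ) ^ rrc π * ∏ B ∈ π.parts, α B.card := by
  rw [partitionedMoment, mixedMoment_toeplitz he hq]
  refine (Finset.sum_nbij blockMax ?_ blockMax_injective.injOn ?_ ?_).symm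
  · intro π hπ
    simp only [Finset.mem_filter, Finset.mem_univ, true_and] at hπ ⊢
    exact fun i => ⟨le_blockMax π i, (le_iff_blockNumber_blockMax π σ).1 hπ i,
      blockMax_blockMax π i⟩
  · intro f hf
    simp only [Finset.coe_filter, Finset.mem_univ, true_and, Set.mem_ofPred_eq] at hf
    obtain ⟨π, rfl⟩ := exists_blockMax_eq (fun i => (hf i).1) fun i => (hf i).2.2
    refine ⟨π, ?_, rfl⟩
    simp only [Finset.coe_filter, Finset.mem_univ, true_and, Set.mem_ofPred_eq]
    exact (le_iff_blockNumber_blockMax π σ).2 fun i => (hf i).2.1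
  · exact fun π _ => (blockWeight_blockMax q α π).symm

end QToeplitz

end

theorem mainTheorem5 {H : Type*} [NormedAddCommGroup H] [InnerProductSpace ℂ H]
    (e : ℕ → H) (he : Orthonormal ℂ e) (q : ℝ) (hq : -1 < q) (hq' : q ≤ 1) (α : ℕ → ℂ) (n : ℕ) :
    (∀ h h' : Fin n → ℕ, (∀ i j, h i = h j ↔ h' i = h' j) →
      QToeplitz.mixedMoment (QToeplitz.vacuumExpectation q)
          (fun _ k => QToeplitz.toeplitz q α (e k)) h
        = QToeplitz.mixedMoment (QToeplitz.vacuumExpectation q)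
          (fun _ k => QToeplitz.toeplitz q α (e k)) h') ∧
    ∀ π : QToeplitz.SetPartition n,
      QToeplitz.partitionedCumulant (QToeplitz.vacuumExpectation q)
          (fun _ k => QToeplitz.toeplitz q α (e k)) π
        = (q : ℂ) ^ QToeplitz.rrc π * ∏ B ∈ π.parts, α B.card := by
  classical
  refine ⟨fun h h' hh => ?_, fun π => ?_⟩
  -- In the moment formula `h` enters only through equalities between its values.
  · rw [QToeplitz.mixedMoment_toeplitz he hq, QToeplitz.mixedMoment_toeplitz he hq]
    simp only [hh]
  · have hIic (σ : QToeplitz.SetPartition n) :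
        Finset.univ.filter (fun τ : QToeplitz.SetPartition n => τ ≤ σ) = Finset.Iic σ := by
      ext τ
      simp
    have key := IncidenceAlgebra.moebius_inversion_bot (𝕜 := ℂ)
      (fun σ : QToeplitz.SetPartition n => (q : ℂ) ^ QToeplitz.rrc σ * ∏ B ∈ σ.parts, α B.card)
      (QToeplitz.partitionedMoment (QToeplitz.vacuumExpectation q)
        (fun _ k => QToeplitz.toeplitz q α (e k)))
      (fun σ => by rw [QToeplitz.partitionedMoment_toeplitz he hq, ← hIic]) π
    rw [key, QToeplitz.partitionedCumulant, ← hIic]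
    refine Finset.sum_congr (by congr) fun σ _ => ?_
    rw [mul_comm]
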